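/- Let $n \ge 3$ and let $C$ be a cycle on $n$ vertices whose vertex set is partitioned into $m$ nonempty subsets $V_1,\ldots,V_m$. Then there exist two disjoint sets $S_1$ and $S_2$ of vertices of $C$ such that - for each $j\in\{1,\ldots,m\}$, exactly one vertex of $V_j$ belongs to neither $S_1$ nor $S_2$; - $\bigl||S_1|-|S_2|\bigr|\le 1$; - $|S_i\cap V_j|\ge \frac{|V_j|}{2}-1$ for each $i\in\{1,2\}$ and each $j\in\{1,\ldots,m\}$; - one of the two sets $S_1,S_2$ is an independent set of $C$ of size $\left\lfloor\frac{n-m}{2}\right\rfloor$, and the subgraph of $C$ induced by the other one has at most $\left\lceil\frac{n-m}{2}\right\rceil-\left\lfloor\frac{n-m}{2}\right\rfloor$ edges. -/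

import Mathlib

/-! Number the vertices along the cycle and encode a pair of disjoint sets by a signed vector `x`,
whose zeros are the vertices left out. It suffices to find `x` whose nonzero signs alternate along
the numbering, with exactly one zero in each class and neither sign on more than half of a class.
Alternation balances the two signs, and the closing edge of the cycle is the only one that can join
equal signs; this needs an odd number of nonzero entries, and then both ends carry the more frequent
sign.

Such an `x` comes from the octahedral Tucker lemma (`octahedral_tucker`). Label a signed vector by a
dominated class and its dominant sign, or, if no class is dominated, by the length and last sign of
a longest alternating subsequence. If all undominated vectors had alternating length below `n - m`,
only `(n - m - 1) + m < n` levels would occur, against Tucker. So some undominated `x` has length at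
least `n - m`. Each class contains a zero of `x`, so `x` has at most `n - m` nonzero entries;
equality holds throughout.

Tucker's lemma is proved mod 2 in Fan's manner: the number of alternating label sets carried by full
flags is shown to be odd by induction on the dimension, splitting the sphere into two antipodal
hemispheres (`fanSum_flagSum_eq_one`). -/

/-! ### Flags of signed vectors as mod 2 chains of labels -/

section FlagSum

variable {L ι : Type*} [DecidableEq L]

/-- Multiplication by the generator `a` in the exterior algebra over `ZMod 2` on the labels, whose
elements are written as functions on finite sets of labels. -/
def labelWedge (a : L) (w : Finset L → ZMod 2) : Finset L → ZMod 2 :=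
  fun B => if a ∈ B then w (B.erase a) else 0

/-- The boundary operator of the exterior algebra over `ZMod 2` on the label set `U`. -/
def labelBoundary (U : Finset L) (w : Finset L → ZMod 2) : Finset L → ZMod 2 :=
  fun B => ∑ c ∈ U \ B, w (insert c B)

/-- Leibniz rule, without signs mod 2. At a set `B` containing `a`, the right-hand boundary has the
extra term `c = a`, which cancels the isolated `w B`. -/
theorem labelBoundary_wedge {U : Finset L} {a : L} (ha : a ∈ U) (w : Finset L → ZMod 2) :
    labelBoundary U (labelWedge a w) = w + labelWedge a (labelBoundary U w) := by
  funext B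
  simp only [labelBoundary, labelWedge, Pi.add_apply]
  by_cases hB : a ∈ B
  · simp only [hB, Finset.mem_insert, or_true, if_true]
    have h : U \ B.erase a = insert a (U \ B) := by
      ext c
      by_cases hc : c = a
      · subst hc; simp [ha]
      · simp [hc]
    rw [h, Finset.sum_insert (by simp [hB]), Finset.insert_erase hB, ← add_assoc,
      CharTwo.add_self_eq_zero, zero_add]
    refine Finset.sum_congr rfl fun c hc => ?_
    rw [Finset.erase_insert_of_ne]
    rintro rfl
    exact (Finset.mem_sdiff.1 hc).2 hB
  · simp only [hB, if_false, add_zero, Finset.mem_insert, or_false]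
    rw [Finset.sum_eq_single a]
    · simp [Finset.erase_insert hB]
    · intro c _ hc
      simp [Ne.symm hc]
    · intro h
      exact absurd (Finset.mem_sdiff.2 ⟨ha, hB⟩) h

theorem labelBoundary_sum (U : Finset L) {κ : Type*} (s : Finset κ)
    (f : κ → Finset L → ZMod 2) :
    labelBoundary U (∑ i ∈ s, f i) = ∑ i ∈ s, labelBoundary U (f i) := by
  funext B
  simp only [labelBoundary, Finset.sum_apply]
  exact Finset.sum_comm

theorem labelWedge_zero (a : L) : labelWedge a (0 : Finset L → ZMod 2) = 0 := by
  funext B; simp [labelWedge]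

variable [Fintype ι] [DecidableEq ι]

/-- The sum of the label sets of all flags of length `k` of signed vectors below `x`, each vector
being obtained from the next one by turning a nonzero entry to zero. -/
def flagSum (lab : (ι → SignType) → L) : ℕ → (ι → SignType) → Finset L → ZMod 2
  | 0, _ => fun B => if B = ∅ then 1 else 0
  | k + 1, x => labelWedge (lab x) (∑ i with x i ≠ 0, flagSum lab k (Function.update x i 0))

/-- Two coordinates can be deleted in either order with the same result, so the terms cancel in
pairs. -/
theorem sum_sum_update_eq_zero (x : ι → SignType) (f : (ι → SignType) → Finset L → ZMod 2) :
    ∑ i with x i ≠ 0, ∑ j with Function.update x i 0 j ≠ 0,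
      f (Function.update (Function.update x i 0) j 0) = 0 := by
  rw [Finset.sum_sigma']
  refine Finset.sum_involution (fun p _ => ⟨p.2, p.1⟩) ?_ ?_ ?_ ?_
  · rintro ⟨i, j⟩ h
    have hij : j ≠ i := by
      rintro rfl
      simp at h
    simp only
    rw [Function.update_comm hij]
    funext B
    exact CharTwo.add_self_eq_zero _
  · rintro ⟨i, j⟩ h _ he
    have hij : j ≠ i := by
      rintro rfl
      simp at h
    simp only [Sigma.mk.injEq] at he
    exact hij he.1
  · rintro ⟨i, j⟩ h
    have hij : j ≠ i := by
      rintro rfl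
      simp at h
    simp only [Finset.mem_sigma, Finset.mem_filter, Finset.mem_univ, true_and,
      Function.update_of_ne hij, Function.update_of_ne hij.symm] at h ⊢
    exact ⟨h.2, h.1⟩
  · rintro ⟨i, j⟩ _
    rfl

/-- Only the deletion of the top label survives: by induction the remaining faces form a double
deletion sum, which vanishes. -/
theorem labelBoundary_flagSum {U : Finset L} {lab : (ι → SignType) → L}
    (hU : ∀ x, x ≠ 0 → lab x ∈ U) (k : ℕ) (x : ι → SignType) :
    labelBoundary U (flagSum lab (k + 1) x) =
      ∑ i with x i ≠ 0, flagSum lab k (Function.update x i 0) := by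
  induction k generalizing x with
  | zero =>
    by_cases hx : x = 0
    · subst hx
      funext B
      simp [flagSum, labelWedge_zero, labelBoundary]
    · rw [flagSum, labelBoundary_wedge (hU x hx), labelBoundary_sum]
      have : ∀ i, labelBoundary U (flagSum lab 0 (Function.update x i 0)) = 0 := by
        intro i
        funext B
        simp [labelBoundary, flagSum]
      simp [this, labelWedge_zero]
  | succ k ih =>
    by_cases hx : x = 0
    · subst hx
      funext B
      simp [flagSum, labelWedge_zero, labelBoundary]
    · rw [flagSum, labelBoundary_wedge (hU x hx), labelBoundary_sum]
      simp only [ih]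
      rw [sum_sum_update_eq_zero, labelWedge_zero, add_zero]

theorem exists_of_flagSum_succ_ne_zero {lab : (ι → SignType) → L} {k : ℕ} {x : ι → SignType}
    {B : Finset L} (h : flagSum lab (k + 1) x B ≠ 0) :
    lab x ∈ B ∧ ∃ i, x i ≠ 0 ∧
      flagSum lab k (Function.update x i 0) (B.erase (lab x)) ≠ 0 := by
  simp only [flagSum, labelWedge] at h
  split_ifs at h with hB
  · refine ⟨hB, ?_⟩
    rw [Finset.sum_apply] at h
    obtain ⟨i, hi, hne⟩ := Finset.exists_ne_zero_of_sum_ne_zero h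
    exact ⟨i, (Finset.mem_filter.1 hi).2, hne⟩
  · exact absurd rfl h

theorem card_of_flagSum_ne_zero {lab : (ι → SignType) → L} {k : ℕ} {x : ι → SignType}
    {B : Finset L} (h : flagSum lab k x B ≠ 0) : B.card = k := by
  induction k generalizing x B with
  | zero =>
    by_contra hB
    apply h
    simp only [flagSum]
    rw [if_neg]
    rintro rfl
    exact hB rfl
  | succ k ih =>
    obtain ⟨hB, i, _, hi⟩ := exists_of_flagSum_succ_ne_zero h
    rw [← Finset.card_erase_add_one hB, ih hi]

theorem exists_le_of_flagSum_ne_zero {lab : (ι → SignType) → L} {k : ℕ} {x : ι → SignType}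
    {B : Finset L} (h : flagSum lab k x B ≠ 0) {b : L} (hb : b ∈ B) :
    ∃ y, y ≠ 0 ∧ (∀ i, y i ≠ 0 → y i = x i) ∧ lab y = b := by
  induction k generalizing x B with
  | zero =>
    have := card_of_flagSum_ne_zero h
    rw [Finset.card_eq_zero] at this
    simp [this] at hb
  | succ k ih =>
    obtain ⟨_, i, hxi, hi⟩ := exists_of_flagSum_succ_ne_zero h
    by_cases hbx : b = lab x
    · refine ⟨x, ?_, fun _ _ => rfl, hbx.symm⟩
      rintro rfl
      exact hxi rfl
    · obtain ⟨y, hy, hle, hl⟩ := ih hi (Finset.mem_erase.2 ⟨hbx, hb⟩)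
      refine ⟨y, hy, fun j hj => ?_, hl⟩
      have := hle j hj
      by_cases hji : j = i
      · subst hji
        simp at this
        exact absurd this hj
      · rwa [Function.update_of_ne hji] at this

end FlagSum

/-! ### Alternating label sets and Fan's functional -/

section Alternation

variable {K : Type*} [DecidableEq K]

/-- The indicator that the labels in `B`, read along a list of levels, alternate in sign starting
with the sign `b`. -/
def altIndicator (B : Finset (K × Bool)) : List K → Bool → ZMod 2
  | [], _ => 1
  | i :: l, b =>
    if (i, b) ∈ B then altIndicator B l (!b)
    else if (i, !b) ∈ B then 0 else altIndicator B l b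

theorem altIndicator_congr {B B' : Finset (K × Bool)} {l : List K}
    (h : ∀ i ∈ l, ∀ b, (i, b) ∈ B ↔ (i, b) ∈ B') (b : Bool) :
    altIndicator B l b = altIndicator B' l b := by
  induction l generalizing b with
  | nil => rfl
  | cons i l ih =>
    have ih := ih fun j hj => h j (List.mem_cons_of_mem _ hj)
    simp only [altIndicator, h i List.mem_cons_self, ih]

/-- For nonempty `B`: if it alternates from `b`, only deleting its last label leaves a set
alternating from `b`; if it alternates from `!b`, only deleting the first does. Otherwise a
surviving deletion must repair a single pair of equal neighbouring signs, and either member of the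
pair will do, giving zero mod 2. For empty `B` both sides vanish. -/
theorem sum_altIndicator_erase {B : Finset (K × Bool)}
    (hB : ∀ i b, (i, b) ∈ B → (i, !b) ∉ B) {l : List K} (hl : l.Nodup) (b : Bool) :
    ∑ a ∈ B with a.1 ∈ l, altIndicator (B.erase a) l b =
      altIndicator B l b + altIndicator B l (!b) := by
  induction l generalizing b with
  | nil => simp [altIndicator, CharTwo.add_self_eq_zero]
  | cons i l ih =>
    obtain ⟨hil, hl⟩ := List.nodup_cons.1 hl
    have ih := ih hl
    have hsplit : ({a ∈ B | a.1 ∈ i :: l} : Finset (K × Bool)) =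
        {a ∈ B | a.1 = i} ∪ {a ∈ B | a.1 ∈ l} := by
      ext a; simp only [List.mem_cons, Finset.mem_filter, Finset.mem_union]; tauto
    have hd : Disjoint ({a ∈ B | a.1 = i} : Finset (K × Bool)) {a ∈ B | a.1 ∈ l} := by
      rw [Finset.disjoint_filter]
      rintro a _ rfl
      exact hil
    rw [hsplit, Finset.sum_union hd]
    have hout : ∀ c b', altIndicator (B.erase (i, c)) l b' = altIndicator B l b' := by
      intro c b'
      refine altIndicator_congr (fun j hj b'' => ?_) b'
      have : j ≠ i := fun h => hil (h ▸ hj)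
      simp [this]
    have hin : ∀ a ∈ B.filter (fun a => a.1 ∈ l), ∀ c, ((i, c) ∈ B.erase a ↔ (i, c) ∈ B) := by
      intro a ha c
      have : (i, c) ≠ a := by
        rintro rfl
        exact hil (Finset.mem_filter.1 ha).2
      simp [this]
    have hfi : ∀ c, (i, c) ∈ B → ({a ∈ B | a.1 = i} : Finset (K × Bool)) = {(i, c)} := by
      intro c hc
      ext ⟨j, d⟩
      simp only [Finset.mem_filter, Finset.mem_singleton, Prod.mk.injEq]
      constructor
      · rintro ⟨h1, rfl⟩
        refine ⟨rfl, ?_⟩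
        by_contra hdc
        have : d = !c := by cases d <;> cases c <;> simp_all
        exact hB _ _ hc (this ▸ h1)
      · rintro ⟨rfl, rfl⟩
        exact ⟨hc, rfl⟩
    by_cases h1 : (i, b) ∈ B
    · have h2 := hB _ _ h1
      rw [hfi b h1, Finset.sum_singleton]
      have : ∑ a ∈ B with a.1 ∈ l, altIndicator (B.erase a) (i :: l) b =
          ∑ a ∈ B with a.1 ∈ l, altIndicator (B.erase a) l (!b) :=
        Finset.sum_congr rfl fun a ha => by simp [altIndicator, hin a ha, h1]
      rw [this, ih]
      simp [altIndicator, h1, h2, hout]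
      rw [add_comm, add_assoc, CharTwo.add_self_eq_zero, add_zero]
    · by_cases h2 : (i, !b) ∈ B
      · rw [hfi (!b) h2, Finset.sum_singleton]
        have : ∑ a ∈ B with a.1 ∈ l, altIndicator (B.erase a) (i :: l) b = 0 :=
          Finset.sum_eq_zero fun a ha => by simp [altIndicator, hin a ha, h1, h2]
        rw [this]
        simp [altIndicator, h1, h2, hout]
      · have h0 : ({a ∈ B | a.1 = i} : Finset (K × Bool)) = ∅ := by
          ext ⟨j, d⟩
          simp only [Finset.mem_filter, Finset.notMem_empty, iff_false]
          rintro ⟨h, rfl⟩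
          cases b <;> cases d <;> simp_all
        have : ∑ a ∈ B with a.1 ∈ l, altIndicator (B.erase a) (i :: l) b =
            ∑ a ∈ B with a.1 ∈ l, altIndicator (B.erase a) l b :=
          Finset.sum_congr rfl fun a ha => by simp [altIndicator, hin a ha, h1, h2]
        rw [h0, this, ih]
        simp [altIndicator, h1, h2]

/-- The antipodal map on labels. -/
def labelFlip (K : Type*) : K × Bool ≃ K × Bool :=
  (Equiv.refl K).prodCongr Equiv.boolNot

@[simp] theorem labelFlip_apply (a : K × Bool) : labelFlip K a = (a.1, !a.2) := rfl

/-- The antipodal map on sets of labels. -/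
def flipSet (B : Finset (K × Bool)) : Finset (K × Bool) := B.map (labelFlip K).toEmbedding

theorem mem_flipSet {B : Finset (K × Bool)} {a : K × Bool} :
    a ∈ flipSet B ↔ (a.1, !a.2) ∈ B := by
  simp only [flipSet, Finset.mem_map_equiv]
  rfl

theorem flipSet_flipSet (B : Finset (K × Bool)) : flipSet (flipSet B) = B := by
  ext a
  simp [mem_flipSet]

theorem altIndicator_flipSet (B : Finset (K × Bool)) (l : List K) (b : Bool) :
    altIndicator (flipSet B) l b = altIndicator B l (!b) := by
  induction l generalizing b with
  | nil => rfl
  | cons i l ih => simp [altIndicator, mem_flipSet, ih]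

/-- Fan's functional: it counts the label sets over the levels `T` which alternate in sign,
starting with a positive one. -/
noncomputable def fanSum (T : Finset K) (w : Finset (K × Bool) → ZMod 2) : ZMod 2 :=
  ∑ B ∈ (T ×ˢ Finset.univ).powerset, altIndicator B T.toList true * w B

theorem fanSum_add (T : Finset K) (w w' : Finset (K × Bool) → ZMod 2) :
    fanSum T (w + w') = fanSum T w + fanSum T w' := by
  simp [fanSum, mul_add, Finset.sum_add_distrib]

theorem fanSum_comp_flipSet (T : Finset K) (w : Finset (K × Bool) → ZMod 2) :
    fanSum T (fun B => w (flipSet B)) =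
      ∑ B ∈ (T ×ˢ Finset.univ).powerset, altIndicator B T.toList false * w B := by
  have hmem : ∀ B ∈ (T ×ˢ (Finset.univ : Finset Bool)).powerset,
      flipSet B ∈ (T ×ˢ (Finset.univ : Finset Bool)).powerset := by
    intro B hB
    rw [Finset.mem_powerset] at hB ⊢
    intro a ha
    have := hB (mem_flipSet.1 ha)
    simpa using this
  refine Finset.sum_bij' (fun B _ => flipSet B) (fun B _ => flipSet B) hmem hmem
    (fun B _ => flipSet_flipSet B) (fun B _ => flipSet_flipSet B) ?_
  intro B _
  rw [altIndicator_flipSet]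
  rfl

/-- The deletion count of `sum_altIndicator_erase`, transposed to `w`; sets alternating from a
negative sign are the flips of those alternating from a positive one. -/
theorem fanSum_labelBoundary (T : Finset K) (w : Finset (K × Bool) → ZMod 2)
    (hw : ∀ B, w B ≠ 0 → ∀ i b, (i, b) ∈ B → (i, !b) ∉ B) :
    fanSum T (labelBoundary (T ×ˢ Finset.univ) w) =
      fanSum T w + fanSum T (fun B => w (flipSet B)) := by
  rw [fanSum_comp_flipSet]
  simp only [fanSum, labelBoundary]
  rw [← Finset.sum_add_distrib]
  -- Exchange inserting `c` outside `B` for deleting `c` from `insert c B`.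
  have hre : ∑ B ∈ (T ×ˢ (Finset.univ : Finset Bool)).powerset, altIndicator B T.toList true *
        ∑ c ∈ (T ×ˢ Finset.univ) \ B, w (insert c B) =
      ∑ B ∈ (T ×ˢ (Finset.univ : Finset Bool)).powerset,
        ∑ c ∈ B, altIndicator (B.erase c) T.toList true * w B := by
    simp only [Finset.mul_sum]
    rw [Finset.sum_sigma', Finset.sum_sigma']
    refine Finset.sum_bij' (fun p _ => ⟨insert p.2 p.1, p.2⟩) (fun p _ => ⟨p.1.erase p.2, p.2⟩)
      ?_ ?_ ?_ ?_ ?_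
    · rintro ⟨B, c⟩ h
      simp only [Finset.mem_sigma, Finset.mem_powerset, Finset.mem_sdiff] at h ⊢
      exact ⟨Finset.insert_subset h.2.1 h.1, Finset.mem_insert_self _ _⟩
    · rintro ⟨B, c⟩ h
      simp only [Finset.mem_sigma, Finset.mem_powerset, Finset.mem_sdiff] at h ⊢
      exact ⟨(Finset.erase_subset _ _).trans h.1, h.1 h.2, Finset.notMem_erase _ _⟩
    · rintro ⟨B, c⟩ h
      simp only [Finset.mem_sigma, Finset.mem_sdiff] at h
      simp [Finset.erase_insert h.2.2]
    · rintro ⟨B, c⟩ h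
      simp only [Finset.mem_sigma] at h
      simp [Finset.insert_erase h.2]
    · rintro ⟨B, c⟩ h
      simp only [Finset.mem_sigma, Finset.mem_sdiff] at h
      simp [Finset.erase_insert h.2.2]
  rw [hre]
  refine Finset.sum_congr rfl fun B hB => ?_
  rw [← Finset.sum_mul, ← add_mul]
  by_cases h0 : w B = 0
  · simp [h0]
  · have := sum_altIndicator_erase (hw B h0) T.nodup_toList true
    rw [Finset.filter_true_of_mem] at this
    · rw [this]; rfl
    · intro a ha
      have := Finset.mem_powerset.1 hB ha
      simpa using this

end Alternation

/-! ### The octahedral Tucker lemma -/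

section Tucker

variable {K ι : Type*} [DecidableEq K] [Fintype ι] [DecidableEq ι]

theorem flagSum_neg {lab : (ι → SignType) → K × Bool}
    (hneg : ∀ x, x ≠ 0 → lab (-x) = labelFlip K (lab x)) (k : ℕ) (x : ι → SignType)
    (B : Finset (K × Bool)) :
    flagSum lab k (-x) B = flagSum lab k x (flipSet B) := by
  induction k generalizing x B with
  | zero =>
    have : flipSet B = ∅ ↔ B = ∅ := by simp [flipSet]
    simp [flagSum, this]
  | succ k ih =>
    by_cases hx : x = 0
    · subst hx
      simp [flagSum, labelWedge_zero]
    · have hupd : ∀ i, Function.update (-x) i 0 = -Function.update x i 0 := by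
        intro i
        funext j
        by_cases hj : j = i
        · subst hj; simp
        · simp [hj]
      have herase : (flipSet B).erase (lab x) = flipSet (B.erase (labelFlip K (lab x))) := by
        ext a
        have : a = lab x ↔ ((a.1, !a.2) : K × Bool) = labelFlip K (lab x) :=
          ((labelFlip K).injective.eq_iff (a := a)).symm
        simp only [Finset.mem_erase, mem_flipSet, ne_eq, this]
      simp only [flagSum, labelWedge, hneg x hx, mem_flipSet, Finset.sum_apply, hupd, ih, herase,
        Pi.neg_apply, labelFlip_apply]
      have : ∀ i, (-x i ≠ 0) ↔ x i ≠ 0 := by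
        intro i
        rcases x i <;> decide
      simp only [this]

/-- The signed vectors with support `T`. -/
def signedWithSupport (T : Finset ι) : Finset (ι → SignType) :=
  Finset.univ.filter fun x => ∀ i, x i ≠ 0 ↔ i ∈ T

theorem mem_signedWithSupport {T : Finset ι} {x : ι → SignType} :
    x ∈ signedWithSupport T ↔ ∀ i, x i ≠ 0 ↔ i ∈ T := by
  simp [signedWithSupport]

/-- The boundary of a hemisphere is its equator: deleting `t` is a bijection onto the vectors
supported on `T`, while for `i ≠ t` the vectors differing only in the sign at `i` cancel. -/
theorem sum_sum_update_hemisphere {T : Finset ι} {t : ι} (ht : t ∉ T)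
    (f : (ι → SignType) → Finset (K × Bool) → ZMod 2) :
    ∑ x ∈ signedWithSupport (insert t T) with x t = 1, ∑ i with x i ≠ 0,
      f (Function.update x i 0) = ∑ x ∈ signedWithSupport T, f x := by
  have h1 : ∀ x ∈ (signedWithSupport (insert t T)).filter (fun x => x t = 1),
      ∑ i with x i ≠ 0, f (Function.update x i 0) =
        f (Function.update x t 0) + ∑ i ∈ T, f (Function.update x i 0) := by
    intro x hx
    have : ({i | x i ≠ 0} : Finset ι) = insert t T := by
      ext i
      simpa using mem_signedWithSupport.1 (Finset.mem_filter.1 hx).1 i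
    rw [this, Finset.sum_insert ht]
  rw [Finset.sum_congr rfl h1, Finset.sum_add_distrib]
  have h2 : ∑ x ∈ signedWithSupport (insert t T) with x t = 1, ∑ i ∈ T,
      f (Function.update x i 0) = 0 := by
    rw [Finset.sum_comm]
    refine Finset.sum_eq_zero fun i hi => ?_
    have hit : t ≠ i := fun h => ht (h ▸ hi)
    refine Finset.sum_involution (fun x _ => Function.update x i (-x i)) ?_ ?_ ?_ ?_
    · intro x _
      rw [Function.update_idem]
      funext B
      exact CharTwo.add_self_eq_zero _
    · intro x hx _ he
      have h0 := (mem_signedWithSupport.1 (Finset.mem_filter.1 hx).1 i).2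
        (Finset.mem_insert_of_mem hi)
      have := congrFun he i
      rw [Function.update_self] at this
      revert h0 this
      rcases x i <;> decide
    · intro x hx
      rw [Finset.mem_filter, mem_signedWithSupport] at hx ⊢
      refine ⟨fun j => ?_, by rw [Function.update_of_ne hit]; exact hx.2⟩
      by_cases hj : j = i
      · subst hj
        rw [Function.update_self, ← hx.1 j]
        rcases x j <;> decide
      · rw [Function.update_of_ne hj]
        exact hx.1 j
    · intro x _
      funext j
      by_cases hj : j = i
      · subst hj; simp
      · simp [hj]
  rw [h2, add_zero]
  refine Finset.sum_bij' (fun x _ => Function.update x t 0) (fun x _ => Function.update x t 1)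
    ?_ ?_ ?_ ?_ ?_
  · intro x hx
    rw [Finset.mem_filter, mem_signedWithSupport] at hx
    rw [mem_signedWithSupport]
    intro j
    by_cases hj : j = t
    · subst hj; simp [ht]
    · simpa [hj] using hx.1 j
  · intro x hx
    rw [mem_signedWithSupport] at hx
    rw [Finset.mem_filter, mem_signedWithSupport]
    refine ⟨fun j => ?_, by simp⟩
    by_cases hj : j = t
    · subst hj; simp
    · simpa [hj] using hx j
  · intro x hx
    rw [Finset.mem_filter] at hx
    rw [Function.update_idem, ← hx.2, Function.update_eq_self]
  · intro x hx
    have h0 : x t = 0 := by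
      by_contra h
      exact ht ((mem_signedWithSupport.1 hx t).1 h)
    rw [Function.update_idem, ← h0, Function.update_eq_self]
  · intro x _
    rfl

theorem sum_signedWithSupport_insert {lab : (ι → SignType) → K × Bool}
    (hneg : ∀ x, x ≠ 0 → lab (-x) = labelFlip K (lab x)) (k : ℕ) (T : Finset ι) (t : ι) :
    ∑ x ∈ signedWithSupport (insert t T), flagSum lab k x =
      (∑ x ∈ signedWithSupport (insert t T) with x t = 1, flagSum lab k x) +
        fun B => (∑ x ∈ signedWithSupport (insert t T) with x t = 1, flagSum lab k x)
          (flipSet B) := by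
  rw [← Finset.sum_filter_add_sum_filter_not _ (fun x => x t = 1)]
  congr 1
  funext B
  rw [Finset.sum_apply, Finset.sum_apply]
  refine Finset.sum_bij' (fun x _ => -x) (fun x _ => -x) ?_ ?_ (fun x _ => ?_)
    (fun x _ => ?_) ?_
  · intro x hx
    rw [Finset.mem_filter, mem_signedWithSupport] at hx ⊢
    have ht := (hx.1 t).2 (Finset.mem_insert_self _ _)
    refine ⟨fun j => ?_, ?_⟩
    · rw [← hx.1 j, Pi.neg_apply]
      rcases x j <;> decide
    · have h2 := hx.2
      rw [Pi.neg_apply]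
      revert ht h2
      rcases x t <;> decide
  · intro x hx
    rw [Finset.mem_filter, mem_signedWithSupport] at hx ⊢
    refine ⟨fun j => ?_, ?_⟩
    · rw [← hx.1 j, Pi.neg_apply]
      rcases x j <;> decide
    · rw [Pi.neg_apply, hx.2]
      decide
  · funext i; simp
  · funext i; simp
  · intro x _
    rw [← flagSum_neg hneg]
    congr 1
    funext i
    simp

/-- Labels of one flag belong to comparable vectors, so it is enough to compare the top vector with
those below and recurse. -/
theorem noncomplementary_of_flagSum_ne_zero {lab : (ι → SignType) → K × Bool}
    (hcompl : ∀ x y, x ≠ 0 → (∀ i, x i ≠ 0 → x i = y i) → (lab x).1 = (lab y).1 →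
      (lab x).2 = (lab y).2)
    {k : ℕ} {x : ι → SignType} {B : Finset (K × Bool)} (h : flagSum lab k x B ≠ 0)
    (i : K) (b : Bool) (hb : (i, b) ∈ B) : (i, !b) ∉ B := by
  induction k generalizing x B with
  | zero =>
    have := card_of_flagSum_ne_zero h
    rw [Finset.card_eq_zero] at this
    simp [this] at hb
  | succ k ih =>
    intro hb'
    have key : ∀ c : Bool, (i, c) ∈ B → (lab x).1 = i → c = (lab x).2 := by
      intro c hc hx
      obtain ⟨y, hy, hle, hl⟩ := exists_le_of_flagSum_ne_zero h hc
      have := hcompl y x hy hle (by rw [hl, hx])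
      rwa [hl] at this
    obtain ⟨_, j, _, hj⟩ := exists_of_flagSum_succ_ne_zero h
    by_cases hx : (lab x).1 = i
    · have h1 := key _ hb hx
      have h2 := key _ hb' hx
      cases b <;> simp_all
    · have hne : ∀ c, (i, c) ≠ lab x := by
        rintro c hc
        exact hx (by rw [← hc])
      exact ih hj (Finset.mem_erase.2 ⟨hne _, hb⟩) (Finset.mem_erase.2 ⟨hne _, hb'⟩)

/-- The sphere on `insert t T` is a hemisphere plus its antipode, so `fanSum_labelBoundary` turns
its Fan sum into that of the boundary of the hemisphere, which is the sphere on `T`. -/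
theorem fanSum_flagSum_eq_one {lab : (ι → SignType) → K × Bool} {U : Finset K}
    (hU : ∀ x, x ≠ 0 → (lab x).1 ∈ U)
    (hneg : ∀ x, x ≠ 0 → lab (-x) = labelFlip K (lab x))
    (hcompl : ∀ x y, x ≠ 0 → (∀ i, x i ≠ 0 → x i = y i) → (lab x).1 = (lab y).1 →
      (lab x).2 = (lab y).2) (T : Finset ι) :
    fanSum U (∑ x ∈ signedWithSupport T, flagSum lab T.card x) = 1 := by
  induction T using Finset.induction_on with
  | empty =>
    have h0 : signedWithSupport (∅ : Finset ι) = {0} := by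
      ext x
      simp [mem_signedWithSupport, funext_iff]
    rw [h0, Finset.sum_singleton, Finset.card_empty, fanSum, Finset.sum_eq_single ∅]
    · have : ∀ l : List K, altIndicator (∅ : Finset (K × Bool)) l true = 1 := by
        intro l
        induction l with
        | nil => rfl
        | cons i l ih => simpa [altIndicator] using ih
      simp [flagSum, this]
    · intro B _ hB
      simp [flagSum, hB]
    · simp
  | insert t T ht ih =>
    rw [Finset.card_insert_of_notMem ht, sum_signedWithSupport_insert hneg, fanSum_add,
      ← fanSum_labelBoundary, labelBoundary_sum]
    · have hU' : ∀ x, x ≠ 0 → lab x ∈ U ×ˢ (Finset.univ : Finset Bool) := by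
        intro x hx
        simp [hU x hx]
      simp only [labelBoundary_flagSum hU']
      rw [sum_sum_update_hemisphere ht]
      exact ih
    · intro B hB
      rw [Finset.sum_apply] at hB
      obtain ⟨x, _, hx⟩ := Finset.exists_ne_zero_of_sum_ne_zero hB
      exact noncomplementary_of_flagSum_ne_zero hcompl hx

/-- The octahedral Tucker lemma. -/
theorem octahedral_tucker {lab : (ι → SignType) → K × Bool} {U : Finset K}
    (hU : ∀ x, x ≠ 0 → (lab x).1 ∈ U)
    (hneg : ∀ x, x ≠ 0 → lab (-x) = labelFlip K (lab x))
    (hcompl : ∀ x y, x ≠ 0 → (∀ i, x i ≠ 0 → x i = y i) → (lab x).1 = (lab y).1 →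
      (lab x).2 = (lab y).2) : Fintype.card ι ≤ U.card := by
  have h := fanSum_flagSum_eq_one hU hneg hcompl Finset.univ
  have hne : fanSum U (∑ x ∈ signedWithSupport (Finset.univ : Finset ι),
      flagSum lab (Finset.univ : Finset ι).card x) ≠ 0 := by
    rw [h]; exact one_ne_zero
  obtain ⟨B, hB, hne⟩ := Finset.exists_ne_zero_of_sum_ne_zero hne
  have hne := right_ne_zero_of_mul hne
  rw [Finset.sum_apply] at hne
  obtain ⟨x, _, hx⟩ := Finset.exists_ne_zero_of_sum_ne_zero hne
  rw [← Finset.card_univ, ← card_of_flagSum_ne_zero hx]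
  -- `B` has as many labels as there are coordinates and no complementary pair, so its labels occupy
  -- distinct levels.
  refine Finset.card_le_card_of_injOn Prod.fst ?_ ?_
  · intro a ha
    have := Finset.mem_powerset.1 hB ha
    simpa using this
  · rintro ⟨i, b⟩ ha ⟨j, c⟩ hc hij
    simp only at hij
    subst hij
    by_contra hbc
    have : c = !b := by cases b <;> cases c <;> simp_all
    exact noncomplementary_of_flagSum_ne_zero hcompl hx i b ha (this ▸ hc)

end Tucker

/-! ### Alternating subsequences of sign sequences -/

/-- The length of the longest subsequence of `x 0, …, x (k - 1)` which alternates in sign and ends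
with the sign `b`. -/
def altLength (x : ℕ → SignType) : SignType → ℕ → ℕ
  | _, 0 => 0
  | b, k + 1 => if x k = b then altLength x (-b) k + 1 else altLength x b k

theorem neg_sign_ne_zero {b : SignType} (hb : b ≠ 0) : -b ≠ 0 := by
  revert b; decide

theorem sign_ne_neg {b : SignType} (hb : b ≠ 0) : b ≠ -b := by
  revert b; decide

/-- Dropping the final term of a subsequence ending in `b` leaves one ending in `-b`. -/
theorem altLength_le_succ (x : ℕ → SignType) (b : SignType) (k : ℕ) :
    altLength x b k ≤ altLength x (-b) k + 1 := by
  induction k generalizing b with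
  | zero => simp [altLength]
  | succ k ih =>
    have h1 := ih b
    have h2 := ih (-b)
    rw [neg_neg] at h2
    simp only [altLength, neg_neg]
    split_ifs <;> omega

theorem altLength_mono {x y : ℕ → SignType} (h : ∀ i, x i ≠ 0 → x i = y i) {b : SignType}
    (hb : b ≠ 0) (k : ℕ) : altLength x b k ≤ altLength y b k := by
  induction k generalizing b with
  | zero => simp [altLength]
  | succ k ih =>
    have hb' : -b ≠ 0 := neg_sign_ne_zero hb
    have h1 := ih hb
    have h2 := ih hb'
    have h3 := altLength_le_succ y b k
    simp only [altLength]
    by_cases hx : x k = b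
    · have hy : y k = b := by rw [← h k (hx ▸ hb), hx]
      simp only [hx, hy, if_true]
      omega
    -- If `y k = b` here, `altLength_le_succ` bounds `altLength y b k` by the new length.
    · simp only [hx, if_false]
      split_ifs <;> omega

theorem altLength_neg (x : ℕ → SignType) (b : SignType) (k : ℕ) :
    altLength (-x) b k = altLength x (-b) k := by
  induction k generalizing b with
  | zero => simp [altLength]
  | succ k ih =>
    have : (-x) k = b ↔ x k = -b := by
      rw [Pi.neg_apply]
      generalize x k = a
      revert a b; decide
    simp only [altLength, ih, this]

/-- The last nonzero term extends only the subsequences ending in its own sign, and makes these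
exactly one longer than the others. Hence the last sign of a longest alternating subsequence is well
defined. -/
theorem altLength_ne {x : ℕ → SignType} {k i : ℕ} (hi : i < k) (hx : x i ≠ 0) :
    altLength x 1 k ≠ altLength x (-1) k := by
  induction k with
  | zero => omega
  | succ k ih =>
    simp only [altLength, neg_neg]
    by_cases h1 : x k = 1
    · have : x k ≠ -1 := by rw [h1]; decide
      simp [h1]
    · by_cases h2 : x k = -1
      · simp [h2]
      · simp only [h1, h2, if_false]
        refine ih ?_
        rcases Nat.lt_succ_iff_lt_or_eq.1 hi with h | rfl
        · exact h
        · exfalso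
          revert hx h1 h2
          generalize x i = a
          revert a; decide

theorem card_filter_range_succ (p : ℕ → Prop) [DecidablePred p] (k : ℕ) :
    ((Finset.range (k + 1)).filter p).card =
      ((Finset.range k).filter p).card + if p k then 1 else 0 := by
  rw [Finset.range_add_one, Finset.filter_insert]
  split_ifs
  · rw [Finset.card_insert_of_notMem (by simp)]
  · simp

theorem altLength_le_card (x : ℕ → SignType) {b : SignType} (hb : b ≠ 0) (k : ℕ) :
    altLength x b k ≤ ((Finset.range k).filter (fun i => x i ≠ 0)).card := by
  induction k generalizing b with
  | zero => simp [altLength]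
  | succ k ih =>
    have hb' : -b ≠ 0 := neg_sign_ne_zero hb
    have h1 := ih hb
    have h2 := ih hb'
    rw [card_filter_range_succ]
    simp only [altLength]
    by_cases hx : x k = b
    · rw [if_pos hx, if_pos (hx ▸ hb)]; omega
    · rw [if_neg hx]; omega

/-- The nonzero terms among `x 0, …, x (k - 1)` alternate in sign and the last one is `b`. -/
def IsAlternating (x : ℕ → SignType) (b : SignType) (k : ℕ) : Prop :=
  altLength x b k = ((Finset.range k).filter (fun i => x i ≠ 0)).card

theorem IsAlternating.of_succ {x : ℕ → SignType} {b : SignType} (hb : b ≠ 0) {k : ℕ}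
    (h : IsAlternating x b (k + 1)) :
    (x k = 0 ∧ IsAlternating x b k) ∨ (x k = b ∧ IsAlternating x (-b) k) := by
  have h1 := altLength_le_card x hb k
  simp only [IsAlternating, altLength] at h ⊢
  rw [card_filter_range_succ] at h
  by_cases hx : x k = b
  · right
    rw [if_pos hx, if_pos (hx ▸ hb)] at h
    exact ⟨hx, by omega⟩
  · left
    rw [if_neg hx] at h
    split_ifs at h with h0
    · omega
    · exact ⟨not_not.1 h0, by omega⟩

theorem IsAlternating.card_eq {x : ℕ → SignType} {b : SignType} (hb : b ≠ 0) {k : ℕ}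
    (h : IsAlternating x b k) :
    ((Finset.range k).filter (fun i => x i = b)).card =
        (((Finset.range k).filter (fun i => x i ≠ 0)).card + 1) / 2 ∧
      ((Finset.range k).filter (fun i => x i = -b)).card =
        ((Finset.range k).filter (fun i => x i ≠ 0)).card / 2 := by
  induction k generalizing b with
  | zero => simp
  | succ k ih =>
    have hb' : -b ≠ 0 := neg_sign_ne_zero hb
    have hbb : b ≠ -b := sign_ne_neg hb
    simp only [card_filter_range_succ]
    rcases h.of_succ hb with ⟨hx, h⟩ | ⟨hx, h⟩
    · have := ih hb h
      simp only [hx, hb.symm, hb'.symm, ne_eq, not_true, if_false]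
      exact this
    · have := ih hb' h
      rw [neg_neg] at this
      simp only [hx, hb, hbb, ne_eq, not_false_eq_true, if_true, if_false] at this ⊢
      omega

theorem IsAlternating.last_eq {x : ℕ → SignType} {b : SignType} (hb : b ≠ 0) {k : ℕ}
    (h : IsAlternating x b (k + 1)) (hx : x k ≠ 0) : x k = b := by
  rcases h.of_succ hb with ⟨h0, _⟩ | ⟨h0, _⟩
  · exact absurd h0 hx
  · exact h0

theorem IsAlternating.ne_succ {x : ℕ → SignType} {b : SignType} (hb : b ≠ 0) {k i : ℕ}
    (h : IsAlternating x b k) (hi : i + 1 < k) (hx : x i ≠ 0) : x i ≠ x (i + 1) := by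
  induction k generalizing b with
  | zero => omega
  | succ k ih =>
    have hb' : -b ≠ 0 := neg_sign_ne_zero hb
    rcases Nat.lt_succ_iff_lt_or_eq.1 hi with hik | rfl
    · rcases h.of_succ hb with ⟨_, h⟩ | ⟨_, h⟩
      · exact ih hb h hik
      · exact ih hb' h hik
    · rcases h.of_succ hb with ⟨h0, _⟩ | ⟨h0, h⟩
      · rw [h0]; exact hx
      · rw [h0, h.last_eq hb' hx]
        exact (sign_ne_neg hb).symm

theorem IsAlternating.first_eq {x : ℕ → SignType} {b : SignType} (hb : b ≠ 0) {k : ℕ}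
    (h : IsAlternating x b (k + 1)) (hx : x 0 ≠ 0) :
    x 0 = if Odd ((Finset.range (k + 1)).filter (fun i => x i ≠ 0)).card then b else -b := by
  induction k generalizing b with
  | zero =>
    rw [card_filter_range_succ, if_pos hx]
    simpa using h.last_eq hb hx
  | succ k ih =>
    have hb' : -b ≠ 0 := neg_sign_ne_zero hb
    rw [card_filter_range_succ]
    rcases h.of_succ hb with ⟨h0, h⟩ | ⟨h0, h⟩
    · rw [ih hb h]
      simp [h0]
    · have hk : x (k + 1) ≠ 0 := h0 ▸ hb
      rw [ih hb' h, if_pos hk]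
      simp only [Nat.odd_add_one, neg_neg]
      split_ifs <;> rfl

/-! ### Dominated classes and their signs -/

section Dominated

variable {V : Type*}

/-- A set of vertices is dominated by a signed vector if one of the signs occurs on more than half
of its vertices, or if the vector vanishes nowhere on it. -/
def IsDominated (A : Finset V) (x : V → SignType) : Prop :=
  A.card < 2 * (A.filter fun v => x v = 1).card ∨
    A.card < 2 * (A.filter fun v => x v = -1).card ∨ ∀ v ∈ A, x v ≠ 0

open Classical in
/-- The sign which occurs on more than half of the vertices of `A`, or else the sign of a fixed
vertex of `A`. -/
noncomputable def dominantSign (A : Finset V) (x : V → SignType) : Bool :=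
  if A.card < 2 * (A.filter fun v => x v = 1).card then true
  else if A.card < 2 * (A.filter fun v => x v = -1).card then false
  else if h : A.Nonempty then decide (x h.choose = 1) else false

theorem card_filter_sign (A : Finset V) (x : V → SignType) :
    (A.filter fun v => x v = 1).card + (A.filter fun v => x v = -1).card +
      (A.filter fun v => x v = 0).card = A.card := by
  rw [Finset.card_filter, Finset.card_filter, Finset.card_filter, ← Finset.sum_add_distrib,
    ← Finset.sum_add_distrib, Finset.card_eq_sum_ones]
  refine Finset.sum_congr rfl fun v _ => ?_
  rcases x v <;> rfl

theorem filter_neg_eq (A : Finset V) (x : V → SignType) (s : SignType) :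
    (A.filter fun v => (-x) v = s) = A.filter fun v => x v = -s := by
  refine Finset.filter_congr fun v _ => ?_
  rw [Pi.neg_apply]
  generalize x v = a
  revert a s; decide

theorem card_filter_mono {x y : V → SignType} (h : ∀ v, x v ≠ 0 → x v = y v) (A : Finset V)
    {s : SignType} (hs : s ≠ 0) :
    (A.filter fun v => x v = s).card ≤ (A.filter fun v => y v = s).card := by
  refine Finset.card_le_card fun v hv => ?_
  rw [Finset.mem_filter] at hv ⊢
  exact ⟨hv.1, by rw [← h v (hv.2 ▸ hs), hv.2]⟩

theorem isDominated_neg (A : Finset V) (x : V → SignType) :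
    IsDominated A (-x) ↔ IsDominated A x := by
  have : ∀ v, (-x) v ≠ 0 ↔ x v ≠ 0 := by
    intro v
    rw [Pi.neg_apply]
    rcases x v <;> decide
  simp only [IsDominated, filter_neg_eq, this, neg_neg]
  tauto

theorem dominantSign_neg {A : Finset V} (hA : A.Nonempty) {x : V → SignType}
    (h : IsDominated A x) : dominantSign A (-x) = !dominantSign A x := by
  have hc := card_filter_sign A x
  simp only [dominantSign, filter_neg_eq, neg_neg, dif_pos hA]
  rcases h with h | h | h
  · have : ¬ A.card < 2 * (A.filter fun v => x v = -1).card := by omega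
    simp [h, this]
  · have : ¬ A.card < 2 * (A.filter fun v => x v = 1).card := by omega
    simp [h, this]
  -- Without zeros and without a majority the two signs tie; the nonzero sign of the fixed vertex
  -- decides.
  · have h0 := h _ hA.choose_spec
    by_cases h1 : A.card < 2 * (A.filter fun v => x v = 1).card
    · have : ¬ A.card < 2 * (A.filter fun v => x v = -1).card := by omega
      simp [h1, this]
    · by_cases h2 : A.card < 2 * (A.filter fun v => x v = -1).card
      · simp [h1, h2]
      · simp only [h1, h2, if_false, Pi.neg_apply]
        rw [← decide_not, decide_eq_decide]
        revert h0
        generalize x _ = a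
        revert a; decide

/-- A strict majority persists because sign counts only grow, and if `x` has no zero on `A` then `y`
agrees with it there. -/
theorem dominantSign_mono {A : Finset V} {x y : V → SignType}
    (hxy : ∀ v, x v ≠ 0 → x v = y v) (h : IsDominated A x) :
    dominantSign A x = dominantSign A y := by
  have hc := card_filter_sign A y
  have h1 := card_filter_mono hxy A (s := 1) (by decide)
  have h2 := card_filter_mono hxy A (s := -1) (by decide)
  rcases h with h | h | h
  · have h' : A.card < 2 * (A.filter fun v => y v = 1).card := by omega
    simp [dominantSign, h, h']
  · have h3 : ¬ A.card < 2 * (A.filter fun v => x v = 1).card := by omega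
    have h4 : ¬ A.card < 2 * (A.filter fun v => y v = 1).card := by omega
    have h5 : A.card < 2 * (A.filter fun v => y v = -1).card := by omega
    simp [dominantSign, h, h3, h4, h5]
  · have hs : ∀ s, (A.filter fun v => x v = s) = A.filter fun v => y v = s := by
      intro s
      refine Finset.filter_congr fun v hv => ?_
      rw [hxy v (h v hv)]
    by_cases hA : A.Nonempty
    · simp only [dominantSign, hs, dif_pos hA, hxy _ (h _ hA.choose_spec)]
    · simp only [dominantSign, hs, dif_neg hA]

end Dominated

/-! ### The labelling and the extraction of an alternating vector -/

section Labelling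

variable {V : Type*} {n m : ℕ}

/-- A signed vector as a sequence, along an enumeration of the coordinates. -/
def signSequence (f : V ≃ Fin n) (x : V → SignType) : ℕ → SignType :=
  fun i => if h : i < n then x (f.symm ⟨i, h⟩) else 0

theorem signSequence_apply (f : V ≃ Fin n) (x : V → SignType) (v : V) :
    signSequence f x (f v) = x v := by
  simp [signSequence]

theorem signSequence_neg (f : V ≃ Fin n) (x : V → SignType) :
    signSequence f (-x) = -signSequence f x := by
  funext i
  simp only [signSequence, Pi.neg_apply]
  split_ifs <;> simp

theorem signSequence_mono (f : V ≃ Fin n) {x y : V → SignType}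
    (h : ∀ v, x v ≠ 0 → x v = y v) (i : ℕ) (hi : signSequence f x i ≠ 0) :
    signSequence f x i = signSequence f y i := by
  simp only [signSequence] at hi ⊢
  split_ifs at hi ⊢
  · exact h _ hi
  · exact absurd rfl hi

theorem card_filter_signSequence [Fintype V] (f : V ≃ Fin n) (x : V → SignType)
    (p : SignType → Prop) [DecidablePred p] :
    ((Finset.range n).filter fun i => p (signSequence f x i)).card =
      (Finset.univ.filter fun v => p (x v)).card := by
  symm
  refine Finset.card_bij (fun v _ => (f v : ℕ)) ?_ ?_ ?_
  · intro v hv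
    simpa [signSequence_apply] using hv
  · intro v _ w _ h
    exact f.injective (Fin.ext h)
  · intro i hi
    rw [Finset.mem_filter, Finset.mem_range] at hi
    refine ⟨f.symm ⟨i, hi.1⟩, ?_, by simp⟩
    simpa [signSequence, hi.1] using hi.2

open Classical in
/-- A choice of an index satisfying `p`, if there is one. -/
noncomputable def pickIndex (p : Fin m → Prop) : Option (Fin m) :=
  if h : ∃ j, p j then some h.choose else none

theorem of_pickIndex_eq_some {p : Fin m → Prop} {j : Fin m} (h : pickIndex p = some j) : p j := by
  unfold pickIndex at h
  split_ifs at h with hp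
  rw [← Option.some.inj h]
  exact hp.choose_spec

theorem not_of_pickIndex_eq_none {p : Fin m → Prop} (h : pickIndex p = none) (j : Fin m) :
    ¬ p j := by
  unfold pickIndex at h
  split_ifs at h with hp
  exact fun hj => hp ⟨j, hj⟩

/-- The label of a signed vector: a dominated class with its dominant sign, or else the length of
the longest alternating subsequence with its last sign. -/
noncomputable def classLabel (P : Fin m → Finset V) (f : V ≃ Fin n) (x : V → SignType) :
    (ℕ ⊕ Fin m) × Bool :=
  match pickIndex fun j => IsDominated (P j) x with
  | some j => (Sum.inr j, dominantSign (P j) x)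
  | none => (Sum.inl (max (altLength (signSequence f x) 1 n) (altLength (signSequence f x) (-1) n)),
      decide (altLength (signSequence f x) (-1) n < altLength (signSequence f x) 1 n))

theorem altLength_signSequence_ne (f : V ≃ Fin n) {x : V → SignType} (hx : x ≠ 0) :
    altLength (signSequence f x) 1 n ≠ altLength (signSequence f x) (-1) n := by
  obtain ⟨v, hv⟩ := Function.ne_iff.1 hx
  refine altLength_ne (f v).isLt ?_
  rwa [signSequence_apply]

theorem classLabel_neg {P : Fin m → Finset V} (hne : ∀ j, (P j).Nonempty) (f : V ≃ Fin n)
    (x : V → SignType) (hx : x ≠ 0) :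
    classLabel P f (-x) = labelFlip _ (classLabel P f x) := by
  unfold classLabel
  -- Antipodal vectors have the same dominated classes, so `pickIndex` makes the same choice for
  -- both.
  simp only [isDominated_neg]
  rcases h : pickIndex fun j => IsDominated (P j) x with _ | j
  · have h1 := altLength_signSequence_ne f hx
    simp only [signSequence_neg, altLength_neg, neg_neg, labelFlip_apply, max_comm, Prod.mk.injEq,
      true_and]
    rw [← decide_not, decide_eq_decide]
    omega
  · simp only [labelFlip_apply, dominantSign_neg (hne j) (of_pickIndex_eq_some h)]

/-- With equal maximal lengths, monotonicity makes the sign attaining the maximum for `x` attain it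
for `y` as well, and only one sign can. -/
theorem classLabel_snd_eq (P : Fin m → Finset V) (f : V ≃ Fin n) (x y : V → SignType)
    (hx : x ≠ 0) (hxy : ∀ v, x v ≠ 0 → x v = y v)
    (h : (classLabel P f x).1 = (classLabel P f y).1) :
    (classLabel P f x).2 = (classLabel P f y).2 := by
  unfold classLabel at h ⊢
  rcases h1 : pickIndex fun j => IsDominated (P j) x with _ | j <;>
  rcases h2 : pickIndex fun j => IsDominated (P j) y with _ | k
  · simp only [h1, h2, Sum.inl.injEq] at h ⊢
    have hm1 := altLength_mono (signSequence_mono f hxy) (b := 1) (by decide) n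
    have hm2 := altLength_mono (signSequence_mono f hxy) (b := -1) (by decide) n
    have hy : y ≠ 0 := by
      obtain ⟨v, hv⟩ := Function.ne_iff.1 hx
      refine Function.ne_iff.2 ⟨v, ?_⟩
      rw [← hxy v hv]
      exact hv
    have hx := altLength_signSequence_ne f hx
    have hy := altLength_signSequence_ne f hy
    rw [decide_eq_decide]
    omega
  · simp [h1, h2] at h
  · simp [h1, h2] at h
  · simp only [h1, h2, Sum.inr.injEq] at h ⊢
    subst h
    exact dominantSign_mono hxy (of_pickIndex_eq_some h1)

theorem exists_altLength_ge [Fintype V] [DecidableEq V] {P : Fin m → Finset V}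
    (hne : ∀ j, (P j).Nonempty) (f : V ≃ Fin n) :
    ∃ x : V → SignType, (∀ j, ¬ IsDominated (P j) x) ∧
      ∃ b : SignType, b ≠ 0 ∧ n ≤ altLength (signSequence f x) b n + m := by
  by_contra hcon
  push Not at hcon
  -- The zero vector dominates no class, as classes are nonempty; its alternating length is 0. This
  -- keeps `n - m` from truncating.
  have h0 : m < n := by
    have := hcon 0 (fun j hj => by
      obtain ⟨v, hv⟩ := hne j
      rcases hj with hj | hj | hj
      · simp at hj
      · simp at hj
      · exact hj v hv rfl) 1 (by decide)
    omega
  have hU : ∀ x : V → SignType, x ≠ 0 →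
      -- There are `n - m - 1` lengths and `m` classes, one level too few for Tucker's lemma.
      (classLabel P f x).1 ∈ (Finset.Ico 1 (n - m)).disjSum (Finset.univ : Finset (Fin m)) := by
    intro x hx
    unfold classLabel
    rcases h1 : pickIndex fun j => IsDominated (P j) x with _ | j
    · have hx' := altLength_signSequence_ne f hx
      have hd := not_of_pickIndex_eq_none h1
      have h2 := hcon x hd 1 (by decide)
      have h3 := hcon x hd (-1) (by decide)
      simp only [Finset.inl_mem_disjSum, Finset.mem_Ico]
      omega
    · simp
  have := octahedral_tucker hU (classLabel_neg hne f) (classLabel_snd_eq P f)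
  rw [Fintype.card_congr f, Finset.card_disjSum] at this
  simp at this
  omega

theorem sum_card_filter_classes [Fintype V] [DecidableEq V] {P : Fin m → Finset V}
    (hdisj : ∀ j k, j ≠ k → Disjoint (P j) (P k)) (hcover : ∀ v, ∃ j, v ∈ P j)
    (p : V → Prop) [DecidablePred p] :
    ∑ j, ((P j).filter p).card = (Finset.univ.filter p).card := by
  rw [← Finset.card_biUnion]
  · congr 1
    ext v
    simp [hcover v]
  · intro j _ k _ hjk
    exact Finset.disjoint_filter_filter (hdisj j k hjk)

/-- One vertex can be removed from each class so that the alternating signs on the remaining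
vertices are balanced on each class. -/
theorem exists_isAlternating [Fintype V] [DecidableEq V] {P : Fin m → Finset V}
    (hne : ∀ j, (P j).Nonempty) (hdisj : ∀ j k, j ≠ k → Disjoint (P j) (P k))
    (hcover : ∀ v, ∃ j, v ∈ P j) (f : V ≃ Fin n) :
    ∃ (x : V → SignType) (b : SignType), b ≠ 0 ∧ IsAlternating (signSequence f x) b n ∧
      (Finset.univ.filter fun v => x v ≠ 0).card + m = n ∧
      ∀ j, ((P j).filter fun v => x v = 0).card = 1 ∧
        ∀ s, s ≠ 0 → (P j).card ≤ 2 * ((P j).filter fun v => x v = s).card + 2 := by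
  obtain ⟨x, hx, b, hb, hlen⟩ := exists_altLength_ge hne f
  have hle := altLength_le_card (signSequence f x) hb n
  rw [card_filter_signSequence f x (fun s => s ≠ 0)] at hle
  have hcard : (Finset.univ.filter fun v => x v = 0).card +
      (Finset.univ.filter fun v => x v ≠ 0).card = n := by
    rw [Finset.card_filter_add_card_filter_not, Finset.card_univ, Fintype.card_congr f,
      Fintype.card_fin]
  have hzero : ∀ j, 1 ≤ ((P j).filter fun v => x v = 0).card := by
    intro j
    by_contra h
    refine hx j (Or.inr (Or.inr fun v hv h0 => h ?_))
    exact Finset.card_pos.2 ⟨v, Finset.mem_filter.2 ⟨hv, h0⟩⟩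
  have hsum := sum_card_filter_classes hdisj hcover (fun v => x v = 0)
  have hm : ∑ _j : Fin m, 1 = m := by simp
  have hge := Finset.sum_le_sum fun j (_ : j ∈ Finset.univ) => hzero j
  -- At least `n - m` entries are nonzero, so at most `m` zeros are shared among `m` classes that
  -- each have one.
  have hone : ∀ j, ((P j).filter fun v => x v = 0).card = 1 := by
    intro j
    exact ((Finset.sum_eq_sum_iff_of_le fun j _ => hzero j).1 (by omega) j
      (Finset.mem_univ j)).symm
  refine ⟨x, b, hb, ?_, by omega, fun j => ⟨hone j, fun s hs => ?_⟩⟩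
  · unfold IsAlternating
    rw [card_filter_signSequence f x (fun s => s ≠ 0)]
    omega
  · have h1 := card_filter_sign (P j) x
    have h2 := hone j
    have h3 : ¬ _ := hx j
    simp only [IsDominated, not_or] at h3
    have : s = 1 ∨ s = -1 := by
      revert s; decide
    rcases this with rfl | rfl <;> omega

end Labelling

/-! ### Edges of the cycle between equal signs -/

theorem cycleGraph_adj_val {n : ℕ} {u v : Fin n} (h : (SimpleGraph.cycleGraph n).Adj u v) :
    u.val + 1 = v.val ∨ v.val + 1 = u.val ∨ (u.val = 0 ∧ v.val + 1 = n) ∨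
      (v.val = 0 ∧ u.val + 1 = n) := by
  have key : ∀ a b : Fin n, (a - b).val = 1 →
      b.val + 1 = a.val ∨ (a.val = 0 ∧ b.val + 1 = n) := by
    intro a b hab
    rw [Fin.sub_def] at hab
    simp only at hab
    have ha := a.isLt
    have hb := b.isLt
    by_cases hlt : n - b.val + a.val < n
    · rw [Nat.mod_eq_of_lt hlt] at hab
      omega
    · rw [Nat.mod_eq_sub_mod (by omega), Nat.mod_eq_of_lt (by omega)] at hab
      omega
  rcases SimpleGraph.cycleGraph_adj'.1 h with h | h
  · rcases key _ _ h with h | h <;> omega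
  · rcases key _ _ h with h | h <;> omega

section Cycle

variable {V : Type*} {n : ℕ} {C : SimpleGraph V}

/-- Along the path, neighbouring nonzero signs differ, so only the closing edge remains. Its ends
are the first and last terms of the alternating sequence, which agree exactly when the number of
terms is odd. -/
theorem alternating_adj_eq (f : C ≃g SimpleGraph.cycleGraph n) {x : V → SignType} {b : SignType}
    (hb : b ≠ 0) (hx : IsAlternating (signSequence f.toEquiv x) b n) {u v : V} (huv : C.Adj u v)
    (hu : x u ≠ 0) (h : x u = x v) :
    x u = b ∧ Odd ((Finset.range n).filter fun i => signSequence f.toEquiv x i ≠ 0).card ∧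
      (((f u).val = 0 ∧ (f v).val + 1 = n) ∨ ((f v).val = 0 ∧ (f u).val + 1 = n)) := by
  have hval : ∀ w, signSequence f.toEquiv x (f w).val = x w := signSequence_apply f.toEquiv x
  have hv : x v ≠ 0 := h ▸ hu
  have hfirst : ∀ w w', (f w).val = 0 → (f w').val + 1 = n → x w ≠ 0 → x w = x w' →
      x w = b ∧ Odd ((Finset.range n).filter fun i => signSequence f.toEquiv x i ≠ 0).card := by
    intro w w' h0 h1 hw hww
    obtain ⟨k, rfl⟩ : ∃ k, n = k + 1 := ⟨n - 1, by omega⟩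
    have hk : (f w').val = k := by omega
    have hk' : signSequence f.toEquiv x k = x w' := by
      have := hval w'
      rwa [hk] at this
    have h0' : signSequence f.toEquiv x 0 = x w := by
      have := hval w
      rwa [h0] at this
    have hl := hx.last_eq hb (by rw [hk', ← hww]; exact hw)
    rw [hk'] at hl
    have hf := hx.first_eq hb (by rw [h0']; exact hw)
    rw [h0', hww, hl] at hf
    refine ⟨hww.trans hl, ?_⟩
    by_contra hodd
    rw [if_neg hodd] at hf
    exact sign_ne_neg hb hf
  rcases cycleGraph_adj_val (f.map_adj_iff.2 huv) with h1 | h1 | h1 | h1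
  · refine absurd h ?_
    rw [← hval u, ← hval v, ← h1]
    exact hx.ne_succ hb (h1 ▸ (f v).isLt) (by rw [hval]; exact hu)
  · refine absurd h.symm ?_
    rw [← hval u, ← hval v, ← h1]
    exact hx.ne_succ hb (h1 ▸ (f u).isLt) (by rw [hval]; exact hv)
  · obtain ⟨h2, h3⟩ := hfirst u v h1.1 h1.2 hu h
    exact ⟨h2, h3, Or.inl h1⟩
  · obtain ⟨h2, h3⟩ := hfirst v u h1.1 h1.2 hv h.symm
    exact ⟨h.trans h2, h3, Or.inr h1⟩

theorem ncard_edgeSet_induce_le (f : C ≃g SimpleGraph.cycleGraph n) {x : V → SignType}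
    {b : SignType} (hb : b ≠ 0) (hx : IsAlternating (signSequence f.toEquiv x) b n) {S : Set V}
    (hS : ∀ v ∈ S, x v = b) :
    (C.induce S).edgeSet.ncard ≤
      ((Finset.range n).filter fun i => signSequence f.toEquiv x i ≠ 0).card % 2 := by
  have hadj : ∀ u v : S, (C.induce S).Adj u v →
      Odd ((Finset.range n).filter fun i => signSequence f.toEquiv x i ≠ 0).card ∧
      (((f u).val = 0 ∧ (f v).val + 1 = n) ∨ ((f v).val = 0 ∧ (f u).val + 1 = n)) := by
    intro u v huv
    have hu := hS u u.2
    have hv := hS v v.2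
    exact (alternating_adj_eq f hb hx huv (hu ▸ hb) (hu.trans hv.symm)).2
  by_cases hodd : Odd ((Finset.range n).filter fun i => signSequence f.toEquiv x i ≠ 0).card
  · rw [Nat.odd_iff.1 hodd]
    have hsub : (C.induce S).edgeSet.Subsingleton := by
      have hinj : ∀ u v : S, (f u).val = (f v).val → u = v := by
        intro u v h
        exact Subtype.ext (f.injective (Fin.ext h))
      intro e he e' he'
      induction e with | _ u v
      induction e' with | _ u' v'
      rw [Sym2.eq_iff]
      rcases (hadj u v he).2 with h | h <;> rcases (hadj u' v' he').2 with h' | h'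
      · exact Or.inl ⟨hinj _ _ (by omega), hinj _ _ (by omega)⟩
      · exact Or.inr ⟨hinj _ _ (by omega), hinj _ _ (by omega)⟩
      · exact Or.inr ⟨hinj _ _ (by omega), hinj _ _ (by omega)⟩
      · exact Or.inl ⟨hinj _ _ (by omega), hinj _ _ (by omega)⟩
    exact (Set.ncard_le_one hsub.finite).2 fun a ha b hb => hsub ha hb
  · have : (C.induce S).edgeSet = ∅ := by
      rw [Set.eq_empty_iff_forall_notMem]
      intro e he
      induction e with | _ u v
      exact hodd (hadj u v he).1
    simp [this]

end Cycle

/-! ### Rounding and the final assembly -/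

theorem floor_half_sub {n m N : ℕ} (h : N + m = n) :
    ⌊((n : ℚ) - (m : ℚ)) / 2⌋ = ((N / 2 : ℕ) : ℤ) := by
  have : ((n : ℚ) - (m : ℚ)) / 2 = (N : ℚ) / (2 : ℕ) := by
    rw [← h]; push_cast; ring
  rw [this, Rat.floor_natCast_div_natCast]
  rfl

theorem ceil_half_sub {n m N : ℕ} (h : N + m = n) :
    ⌈((n : ℚ) - (m : ℚ)) / 2⌉ = ((N / 2 : ℕ) : ℤ) + ((N % 2 : ℕ) : ℤ) := by
  have hN : (N : ℚ) = 2 * ((N / 2 : ℕ) : ℚ) + ((N % 2 : ℕ) : ℚ) := by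
    exact_mod_cast (Nat.div_add_mod N 2).symm
  rw [Int.ceil_eq_iff]
  rw [← h]
  simp only [Int.cast_add, Int.cast_natCast, Nat.cast_add]
  rcases Nat.mod_two_eq_zero_or_one N with h2 | h2 <;> rw [h2] at hN ⊢ <;> push_cast at hN ⊢ <;>
    constructor <;> linarith

theorem corollary1 {V : Type*} [Fintype V] [DecidableEq V] (n m : ℕ) (hn : 3 ≤ n)
    (C : SimpleGraph V) (hC : Nonempty (C ≃g SimpleGraph.cycleGraph n))
    (P : Fin m → Finset V) (hne : ∀ j, (P j).Nonempty)
    (hdisj : ∀ j k, j ≠ k → Disjoint (P j) (P k)) (hcover : ∀ v, ∃ j, v ∈ P j) :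
    ∃ S : Fin 2 → Finset V,
      Disjoint (S 0) (S 1) ∧
      (∀ j, (P j \ (S 0 ∪ S 1)).card = 1) ∧
      |((S 0).card : ℤ) - ((S 1).card : ℤ)| ≤ 1 ∧
      (∀ i j, ((P j).card : ℚ) / 2 - 1 ≤ ((S i ∩ P j).card : ℚ)) ∧
      ∃ i k, i ≠ k ∧
        C.IsIndepSet (S i : Set V) ∧
        ((S i).card : ℤ) = ⌊((n : ℚ) - (m : ℚ)) / 2⌋ ∧
        ((C.induce (S k : Set V)).edgeSet.ncard : ℤ) ≤
          ⌈((n : ℚ) - (m : ℚ)) / 2⌉ - ⌊((n : ℚ) - (m : ℚ)) / 2⌋ := by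
  obtain ⟨f⟩ := hC
  obtain ⟨x, b, hb, halt, hN, hP⟩ := exists_isAlternating hne hdisj hcover f.toEquiv
  have hcard := card_filter_signSequence f.toEquiv x (fun s => s ≠ 0)
  have hcb := card_filter_signSequence f.toEquiv x (fun s => s = b)
  have hcb' := card_filter_signSequence f.toEquiv x (fun s => s = -b)
  obtain ⟨h1, h2⟩ := halt.card_eq hb
  set N := (Finset.univ.filter fun v => x v ≠ 0).card with hNdef
  rw [hcb, hcard] at h1
  rw [hcb', hcard] at h2
  have hnb := neg_sign_ne_zero hb
  -- The last sign `b` occurs `(N + 1) / 2` times and may contain the closing edge; `-b` occurs `N /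
  -- 2` times and gives the independent set.
  refine ⟨![Finset.univ.filter fun v => x v = -b, Finset.univ.filter fun v => x v = b],
    ?_, ?_, ?_, ?_, 0, 1, by decide, ?_, ?_, ?_⟩
  · simp only [Matrix.cons_val_zero, Matrix.cons_val_one]
    rw [Finset.disjoint_filter]
    intro v _ h h'
    exact sign_ne_neg hb (h'.symm.trans h)
  · intro j
    refine Eq.trans (congrArg Finset.card ?_) (hP j).1
    ext v
    simp only [Matrix.cons_val_zero, Matrix.cons_val_one, Finset.mem_sdiff, Finset.mem_union,
      Finset.mem_filter, Finset.mem_univ, true_and, and_congr_right_iff]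
    intro _
    revert hb
    generalize x v = a
    clear * -
    revert a b; decide
  · simp only [Matrix.cons_val_zero, Matrix.cons_val_one]
    rw [h1, h2, abs_le]
    omega
  · have hgoal : ∀ s, s ≠ 0 → ∀ j, ((P j).card : ℚ) / 2 - 1 ≤
        (((Finset.univ.filter fun v => x v = s) ∩ P j).card : ℚ) := by
      intro s hs j
      have : (Finset.univ.filter fun v => x v = s) ∩ P j = (P j).filter fun v => x v = s := by
        ext v
        simp [and_comm]
      rw [this]
      have h : ((P j).card : ℚ) ≤ 2 * (((P j).filter fun v => x v = s).card : ℚ) + 2 := by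
        exact_mod_cast (hP j).2 s hs
      linarith
    intro i j
    fin_cases i
    · exact hgoal _ hnb j
    · exact hgoal _ hb j
  · intro u hu v hv _ huv
    simp only [Matrix.cons_val_zero, Finset.coe_filter, Finset.mem_univ, true_and,
      Set.mem_ofPred_eq] at hu hv
    have := (alternating_adj_eq f hb halt huv (hu ▸ hnb) (hu.trans hv.symm)).1
    exact sign_ne_neg hb (this.symm.trans hu)
  · rw [floor_half_sub hN]
    exact_mod_cast h2
  · rw [floor_half_sub hN, ceil_half_sub hN]
    have := ncard_edgeSet_induce_le f hb halt
      (S := ((Finset.univ.filter fun v => x v = b : Finset V) : Set V)) (fun v hv => by simpa using hv)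
    rw [hcard] at this
    simp only [Matrix.cons_val_one]
    have h : ((N / 2 : ℕ) : ℤ) + ((N % 2 : ℕ) : ℤ) - ((N / 2 : ℕ) : ℤ) = ((N % 2 : ℕ) : ℤ) := by
      ring
    rw [h]
    exact_mod_cast this
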